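/- For $a\in\mathbb R$ let $\mathrm{pos}(a)=1$ if $a>0$ and $\mathrm{pos}(a)=0$ otherwise; a linear threshold function (LTF) on $\mathbb R^d$ is a function $x\mapsto \mathrm{pos}(r^{\mathsf T}x+c)$ with $r\in\mathbb R^d$, $c\in\mathbb R$. There is an absolute constant $C_0>0$ such that the following holds. Let $1\le k\le q-1$ be integers, $\mathcal D$ a probability distribution on $\mathbb R^d$, and $f$ an LTF with $\Pr_{\mathcal D}[f(x)=1]>0$ and $\Pr_{\mathcal D}[f(x)=0]>0$. A random bag consists of $q$ independent vectors, $k$ of them distributed as $x\sim\mathcal D$ conditioned on $f(x)=1$ and $q-k$ of them as $x\sim\mathcal D$ conditioned on $f(x)=0$. Let $0<\varepsilon<\frac1{4q}$, $\delta>0$, and let $\mathcal M$ be a collection of $m$ iid random bags, where $$m\;\ge\; C_0\, d\,\bigl(\log q+\log(1/\delta)\bigr)/\varepsilon^2 .$$ For an LTF $h$ let $\mathrm{BagErr}_{\mathrm{sample}}(h,\mathcal M)$ be the fraction of the bags $B\in\mathcal M$ for which the average of $h(x)$ over $x\in B$ differs from $k/q$. Then, with probability at least $1-\delta$ over $\mathcal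 M$, every LTF $h$ with $\mathrm{BagErr}_{\mathrm{sample}}(h,\mathcal M)\le\varepsilon$ satisfies: (i) if $k\ne q/2$, then $\Pr_{\mathcal D}[f(x)\ne h(x)]\le 4\varepsilon$; (ii) if $k=q/2$, then $\Pr_{\mathcal D}[f(x)\ne h(x)]\le 4\varepsilon$ or $\Pr_{\mathcal D}[f(x)\ne 1-h(x)]\le 4\varepsilon$. -/

import Mathlib

open MeasureTheory ProbabilityTheory

noncomputable section

/-- Instances: vectors of `ℝ^d`. -/
abbrev Instance (d : ℕ) : Type := EuclideanSpace ℝ (Fin d)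

/-- A bag of `q` instances, listed with multiplicity. -/
abbrev Bag (d q : ℕ) : Type := Fin q → Instance d

/-- `pos a = 1` if `a > 0`, and `0` otherwise. -/
def pos (a : ℝ) : ℝ := if 0 < a then 1 else 0

/-- `h` is a linear threshold function `x ↦ pos (rᵀ x + c)`. -/
def IsLTF {d : ℕ} (h : Instance d → ℝ) : Prop :=
  ∃ (r : Instance d) (c : ℝ), ∀ x, h x = pos (inner ℝ r x + c)

/-- `𝒟` conditioned on the event `f(x) = a`. -/
def condLabel {d : ℕ} (f : Instance d → ℝ) (𝒟 : Measure (Instance d)) (a : ℝ) :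
    Measure (Instance d) :=
  ProbabilityTheory.cond 𝒟 {x | f x = a}

/-- The law of a random bag: `q` independent instances, the first `k` of them drawn from `𝒟`
conditioned on `f = 1`, the other `q - k` drawn from `𝒟` conditioned on `f = 0`. -/
def bagOracle {d : ℕ} (f : Instance d → ℝ) (𝒟 : Measure (Instance d)) (q k : ℕ) :
    Measure (Bag d q) :=
  Measure.pi fun i : Fin q => if (i : ℕ) < k then condLabel f 𝒟 1 else condLabel f 𝒟 0

/-- The law of a collection of `m` iid bags. -/
def sampleLaw {d : ℕ} (f : Instance d → ℝ) (𝒟 : Measure (Instance d)) (q k m : ℕ) :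
    Measure (Fin m → Bag d q) :=
  Measure.pi fun _ : Fin m => bagOracle f 𝒟 q k

/-- The average label that `h` gives to the instances of a bag. -/
def bagAvg {d q : ℕ} (h : Instance d → ℝ) (B : Bag d q) : ℝ :=
  (∑ i, h (B i)) / (q : ℝ)

/-- The fraction of the sampled bags on which the average label of `h` differs from `k / q`. -/
def bagErrSample {d q m : ℕ} (h : Instance d → ℝ) (k : ℕ) (M : Fin m → Bag d q) : ℝ :=
  ((Finset.univ.filter fun j : Fin m => bagAvg h (M j) ≠ (k : ℝ) / (q : ℝ)).card : ℝ) / (m : ℝ)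

/-- The instance-level disagreement probability `Pr_𝒟[f(x) ≠ g(x)]`. -/
def instErr {d : ℕ} (𝒟 : Measure (Instance d)) (f g : Instance d → ℝ) : ℝ :=
  𝒟.real {x | f x ≠ g x}

end

/-!
The proof has two independent halves.

*Small bag error over the distribution suffices.* Let the bag error of `h` over the distribution be
at most `η = 2 ε < 1 / (2 q)`, and fix all instances of a bag but one. At most one of the two labels
of the remaining instance gives the right total, so the label of a single instance is nearly
deterministic: under each of the two conditional laws, `h` equals some constant up to `η`
(`min_le_measureReal_sum_ne`). By a union bound all `q` labels take these constant values with
probability at least `1 - q η > η`, so the constants give the total `k`. Writing `a` and `b` for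
them, `k a + (q - k) b = k` leaves only `(a, b) = (1, 0)`, or `(0, 1)` when `k = q / 2`
(`bag_dichotomy`). In both cases the error on single instances is at most `η`
(`instErr_le_of_bagOracle_errorBags_le`).

*Empirical bag error at most `ε` forces bag error at most `2 ε` over the distribution*, for all
threshold functions at once. This is a uniform convergence bound with relative deviation, proved by
comparison with a second sample and random exchanges between the two
(`measure_exists_hitCount_le`). The relative form is essential: an additive Hoeffding bound together
with a union bound would cost an additional factor `log (1 / ε)` in the sample size, whereas here
the exponent is linear in `ε m`, and `log (1 / ε) / ε` is dominated by `1 / ε ^ 2`. The number of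
traces of half-spaces is bounded by Radon's theorem (`card_le_of_shattered_by_halfSpace`) and the
Sauer–Shelah lemma (`card_mul_pow_le_of_shatters`).

The set of bad samples is a union over uncountably many threshold functions. Its outer measure is
bounded, and the event in the theorem is the complement of a measurable hull of it.
-/

/-! ### Uniform convergence with relative deviation -/

/-- The number of entries of the sample `M` that lie in `A`, as a real number. -/
noncomputable def hitCount {β : Type*} {m : ℕ} (A : Set β) (M : Fin m → β) : ℝ :=
  ∑ j, A.indicator 1 (M j)

theorem measurable_hitCount {β : Type*} [MeasurableSpace β] {m : ℕ} {A : Set β}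
    (hA : MeasurableSet A) : Measurable (hitCount A : (Fin m → β) → ℝ) := by
  unfold hitCount
  exact Finset.measurable_sum _ fun j _ =>
    (measurable_one.indicator hA).comp (measurable_pi_apply j)

theorem hitCount_congr {β : Type*} {m : ℕ} {A B : Set β} {M : Fin m → β}
    (h : ∀ j, M j ∈ A ↔ M j ∈ B) : hitCount A M = hitCount B M := by
  classical
  unfold hitCount
  exact Finset.sum_congr rfl fun j _ => by simp only [Set.indicator_apply, h j]

/-- A Chernoff bound on the lower tail, with the exponential weight `exp (-hitCount / 4)`: once the
expected number of hits is at least `24`, three quarters of it are reached with probability at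
least `1 / 2`. -/
theorem half_le_hitCount {β : Type*} [MeasurableSpace β] (P : Measure β) [IsProbabilityMeasure P]
    {A : Set β} (hA : MeasurableSet A) {m : ℕ} (hm : 24 ≤ P.real A * m) :
    1 / 2 ≤ (Measure.pi fun _ : Fin m => P).real {M | 3 / 4 * (P.real A * m) ≤ hitCount A M} := by
  set p := P.real A with hp
  set Q := Measure.pi fun _ : Fin m => P with hQ
  have hmeas := measurable_hitCount (m := m) hA
  have hg : ∀ x, Real.exp (-(1 / 4) * A.indicator 1 x)
      = 1 - (1 - Real.exp (-(1 / 4))) * A.indicator (fun _ => (1 : ℝ)) x := by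
    intro x
    by_cases hx : x ∈ A <;> simp [hx]
  have hint : ∫ x, Real.exp (-(1 / 4) * A.indicator 1 x) ∂P = 1 - (1 - Real.exp (-(1 / 4))) * p := by
    simp_rw [hg]
    rw [integral_sub (integrable_const _)
      (((integrable_const (1 : ℝ)).indicator hA).const_mul _), integral_const_mul,
      integral_indicator_const _ hA]
    simp [hp]
  have hexp : ∀ M : Fin m → β, Real.exp (-(1 / 4) * hitCount A M)
      = ∏ j, Real.exp (-(1 / 4) * A.indicator 1 (M j)) := by
    intro M
    rw [← Real.exp_sum, hitCount, Finset.mul_sum]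
  have hnn : ∀ M : Fin m → β, 0 ≤ hitCount A M := fun M =>
    Finset.sum_nonneg fun j _ => Set.indicator_nonneg (fun _ _ => zero_le_one) _
  have hI : ∫ M, Real.exp (-(1 / 4) * hitCount A M) ∂Q = (1 - (1 - Real.exp (-(1 / 4))) * p) ^ m := by
    simp_rw [hexp]
    rw [hQ, integral_fintype_prod_eq_prod (f := fun _ x => Real.exp (-(1 / 4) * A.indicator 1 x))]
    rw [Finset.prod_const, hint, Finset.card_univ, Fintype.card_fin]
  have hinteg : Integrable (fun M => Real.exp (-(1 / 4) * hitCount A M)) Q := by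
    refine Integrable.of_bound (C := 1) (by fun_prop) (Filter.Eventually.of_forall fun M => ?_)
    rw [Real.norm_eq_abs, abs_of_pos (Real.exp_pos _)]
    exact Real.exp_le_one_iff.2 (by nlinarith [hnn M])
  have hmarkov := mul_meas_ge_le_integral_of_nonneg (μ := Q)
    (Filter.Eventually.of_forall fun M => (Real.exp_pos (-(1 / 4) * hitCount A M)).le) hinteg
    (Real.exp (-(1 / 4) * (3 / 4 * (p * m))))
  rw [hI] at hmarkov
  have hp0 : 0 ≤ p := measureReal_nonneg
  have hp1 : p ≤ 1 := measureReal_le_one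
  have he : Real.exp (-(1 / 4)) ≤ 781 / 1000 := by
    rw [Real.exp_neg, inv_le_comm₀ (Real.exp_pos _) (by norm_num)]
    refine le_trans ?_ (Real.quadratic_le_exp_of_nonneg (by norm_num : (0 : ℝ) ≤ 1 / 4))
    norm_num
  have hb : (1 - (1 - Real.exp (-(1 / 4))) * p) ^ m ≤ Real.exp (-(219 / 1000 * (p * m))) := by
    have h1 : 1 - (1 - Real.exp (-(1 / 4))) * p ≤ Real.exp (-(219 / 1000 * p)) := by
      have := Real.add_one_le_exp (-(219 / 1000 * p))
      nlinarith
    have h0 : 0 ≤ 1 - (1 - Real.exp (-(1 / 4))) * p := by nlinarith [Real.exp_pos (-(1 / 4))]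
    calc _ ≤ Real.exp (-(219 / 1000 * p)) ^ m := pow_le_pow_left₀ h0 h1 m
      _ = _ := by rw [← Real.exp_nat_mul]; congr 1; ring
  have hhalf : Q.real {M | Real.exp (-(1 / 4) * (3 / 4 * (p * m)))
      ≤ Real.exp (-(1 / 4) * hitCount A M)} ≤ 1 / 2 := by
    have h2 : Real.exp (-(219 / 1000 * (p * m)))
        ≤ Real.exp (-(1 / 4) * (3 / 4 * (p * m))) * (1 / 2) := by
      have : (1 / 2 : ℝ) = Real.exp (-Real.log 2) := by
        rw [Real.exp_neg, Real.exp_log (by norm_num)]; norm_num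
      rw [this, ← Real.exp_add]
      refine Real.exp_le_exp.2 ?_
      have := Real.log_two_lt_d9
      linarith
    exact le_of_mul_le_mul_left (hmarkov.trans (hb.trans h2)) (Real.exp_pos _)
  have hcompl : {M : Fin m → β | 3 / 4 * (p * m) ≤ hitCount A M}ᶜ ⊆
      {M | Real.exp (-(1 / 4) * (3 / 4 * (p * m))) ≤ Real.exp (-(1 / 4) * hitCount A M)} := by
    intro M hM
    simp only [Set.mem_compl_iff, Set.mem_ofPred_eq, not_le] at hM
    exact Real.exp_le_exp.2 (by linarith)
  have h3 := measureReal_mono (μ := Q) hcompl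
  rw [probReal_compl_eq_one_sub (measurableSet_le measurable_const hmeas)] at h3
  linarith

/-- Exchange `a j` and `b j` independently with probability `1 / 2` each. It is exponentially
unlikely that the `a`s then sum to at most `T` and the `b`s to at least `3 / 2 * T`. The bound does
not depend on `m`, which is what makes a threshold `T` proportional to `ε` affordable. The weight
`exp (B / 10 - 9 * A / 80)` of the two sums `A`, `B` has mean at most `1`, because each of its
factors does, and it is at least `exp (3 / 80 * T)` on the event. -/
theorem card_swap_le {m : ℕ} (a b : Fin m → ℝ) (ha : ∀ j, a j = 0 ∨ a j = 1)
    (hb : ∀ j, b j = 0 ∨ b j = 1) (T : ℝ) :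
    ((Finset.univ.filter fun σ : Fin m → Bool =>
      ∑ j, (if σ j then b j else a j) ≤ T ∧ 3 / 2 * T ≤ ∑ j, (if σ j then a j else b j)).card : ℝ)
      ≤ 2 ^ m * Real.exp (-(3 / 80 * T)) := by
  set F := Finset.univ.filter fun σ : Fin m → Bool =>
      ∑ j, (if σ j then b j else a j) ≤ T ∧ 3 / 2 * T ≤ ∑ j, (if σ j then a j else b j)
  set g : Fin m → Bool → ℝ := fun j x =>
    Real.exp (1 / 10 * (if x then a j else b j) - 9 / 80 * (if x then b j else a j)) with hg
  have hs : Real.exp (1 / 10) ≤ 1.1052 := by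
    have := Real.exp_bound' (x := 1 / 10) (by norm_num) (by norm_num) (n := 4) (by norm_num)
    refine this.trans ?_
    norm_num [Finset.sum_range_succ, Nat.factorial]
  have ht : Real.exp (-(9 / 80)) ≤ 0.894 := by
    rw [Real.exp_neg, inv_le_comm₀ (Real.exp_pos _) (by norm_num)]
    refine le_trans ?_ (Real.quadratic_le_exp_of_nonneg (by norm_num : (0 : ℝ) ≤ 9 / 80))
    norm_num
  have hprod : ∏ j, (g j true + g j false) ≤ 2 ^ m := by
    refine (Finset.prod_le_prod (g := fun _ => (2 : ℝ))
      (fun j _ => by positivity) fun j _ => ?_).trans (by simp)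
    have h1 : Real.exp (-(1 / 80)) ≤ 1 := Real.exp_le_one_iff.2 (by norm_num)
    -- the constants satisfy `exp (1 / 10) + exp (-9 / 80) ≤ 2`, the case `a j ≠ b j`
    rcases ha j with h | h <;> rcases hb j with h' | h' <;> simp [hg, h, h'] <;>
      norm_num at hs ht ⊢ <;> linarith
  have hsum : ∑ σ : Fin m → Bool, ∏ j, g j (σ j) = ∏ j, (g j true + g j false) := by
    rw [← Fintype.prod_sum]
    simp
  have hlow : (F.card : ℝ) * Real.exp (3 / 80 * T) ≤ ∑ σ : Fin m → Bool, ∏ j, g j (σ j) := by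
    calc (F.card : ℝ) * Real.exp (3 / 80 * T) = ∑ σ ∈ F, Real.exp (3 / 80 * T) := by simp
      _ ≤ ∑ σ ∈ F, ∏ j, g j (σ j) := by
        refine Finset.sum_le_sum fun σ hσ => ?_
        obtain ⟨h1, h2⟩ := (Finset.mem_filter.1 hσ).2
        simp only [hg]
        rw [← Real.exp_sum, Finset.sum_sub_distrib, ← Finset.mul_sum, ← Finset.mul_sum]
        exact Real.exp_le_exp.2 (by linarith)
      _ ≤ _ := Finset.sum_le_sum_of_subset_of_nonneg (Finset.subset_univ _)
          fun σ _ _ => Finset.prod_nonneg fun j _ => (Real.exp_pos _).le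
  rw [Real.exp_neg, ← div_eq_mul_inv, le_div_iff₀ (Real.exp_pos _)]
  exact hlow.trans (hsum.le.trans hprod)

/-- Exchange the `j`-th entries of the two samples for every `j` with `σ j = true`. -/
def swapSamples {β : Type*} {m : ℕ} (σ : Fin m → Bool) (z : (Fin m → β) × (Fin m → β)) :
    (Fin m → β) × (Fin m → β) :=
  (fun j => if σ j then z.2 j else z.1 j, fun j => if σ j then z.1 j else z.2 j)

theorem measurePreserving_swapSamples {β : Type*} [MeasurableSpace β] (P : Measure β)
    [IsProbabilityMeasure P] {m : ℕ} (σ : Fin m → Bool) :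
    MeasurePreserving (swapSamples σ)
      ((Measure.pi fun _ : Fin m => P).prod (Measure.pi fun _ : Fin m => P))
      ((Measure.pi fun _ : Fin m => P).prod (Measure.pi fun _ : Fin m => P)) := by
  have he := measurePreserving_arrowProdEquivProdArrow β β (Fin m) (fun _ => P) (fun _ => P)
  have hpi : MeasurePreserving
      (fun (w : Fin m → β × β) j => (if σ j then Prod.swap else id) (w j))
      (Measure.pi fun _ => P.prod P) (Measure.pi fun _ => P.prod P) := by
    refine measurePreserving_pi _ _ fun j => ?_
    cases σ j
    · exact MeasurePreserving.id _
    · exact Measure.measurePreserving_swap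
  have := (he.comp hpi).comp (he.symm _)
  convert! this using 1
  funext z
  refine Prod.ext (funext fun j => ?_) (funext fun j => ?_) <;>
    cases h : σ j <;>
    simp [swapSamples, h, MeasurableEquiv.arrowProdEquivProdArrow, Equiv.arrowProdEquivProdArrow]

/-- The double-sample bound. Because the law of a pair of samples is invariant under exchanges, the
event has the probability that a random exchange of a fixed pair lands in it, and for a fixed pair
at most `K` members of the family have to be considered. The countable subfamily `Θ₀` with the same
traces on finite sets makes the event measurable, which this averaging needs. -/
theorem measure_prod_exists_hitCount_le {β Θ : Type*} [MeasurableSpace β] (P : Measure β)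
    [IsProbabilityMeasure P] {A : Θ → Set β} (hA : ∀ θ, MeasurableSet (A θ))
    {Θ₀ : Set Θ} (hΘ₀ : Θ₀.Countable)
    (hdense : ∀ (s : Finset β) (θ : Θ), ∃ θ₀ ∈ Θ₀, ∀ x ∈ s, x ∈ A θ ↔ x ∈ A θ₀)
    {m : ℕ} {K : ℝ}
    (hgrowth : ∀ s : Finset β, s.card ≤ 2 * m → ∃ t : Finset Θ, (t.card : ℝ) ≤ K ∧
      ∀ θ, ∃ θ' ∈ t, ∀ x ∈ s, x ∈ A θ ↔ x ∈ A θ') (T : ℝ) :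
    MeasurableSet {z : (Fin m → β) × (Fin m → β) |
        ∃ θ, hitCount (A θ) z.1 ≤ T ∧ 3 / 2 * T ≤ hitCount (A θ) z.2} ∧
    ((Measure.pi fun _ : Fin m => P).prod (Measure.pi fun _ : Fin m => P))
      {z | ∃ θ, hitCount (A θ) z.1 ≤ T ∧ 3 / 2 * T ≤ hitCount (A θ) z.2}
      ≤ ENNReal.ofReal (K * Real.exp (-(3 / 80 * T))) := by
  classical
  set E := {z : (Fin m → β) × (Fin m → β) |
        ∃ θ, hitCount (A θ) z.1 ≤ T ∧ 3 / 2 * T ≤ hitCount (A θ) z.2} with hE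
  set μ := (Measure.pi fun _ : Fin m => P).prod (Measure.pi fun _ : Fin m => P)
  let pts : (Fin m → β) × (Fin m → β) → Finset β := fun z =>
    Finset.univ.image z.1 ∪ Finset.univ.image z.2
  have hpts1 : ∀ z j, z.1 j ∈ pts z := fun z j =>
    Finset.mem_union_left _ (Finset.mem_image_of_mem _ (Finset.mem_univ _))
  have hpts2 : ∀ z j, z.2 j ∈ pts z := fun z j =>
    Finset.mem_union_right _ (Finset.mem_image_of_mem _ (Finset.mem_univ _))
  have hptsc : ∀ z, (pts z).card ≤ 2 * m := fun z => by
    refine (Finset.card_union_le _ _).trans ?_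
    have h1 := Finset.card_image_le (s := (Finset.univ : Finset (Fin m))) (f := z.1)
    have h2 := Finset.card_image_le (s := (Finset.univ : Finset (Fin m))) (f := z.2)
    simp only [Finset.card_univ, Fintype.card_fin] at h1 h2
    omega
  have hEmeas : MeasurableSet E := by
    have : E = ⋃ θ ∈ Θ₀, {z : (Fin m → β) × (Fin m → β) |
        hitCount (A θ) z.1 ≤ T ∧ 3 / 2 * T ≤ hitCount (A θ) z.2} := by
      ext z
      simp only [hE, Set.mem_ofPred_eq, Set.mem_iUnion, exists_prop]
      constructor
      · rintro ⟨θ, h1, h2⟩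
        obtain ⟨θ₀, h0, hθ⟩ := hdense (pts z) θ
        refine ⟨θ₀, h0, ?_, ?_⟩
        · rwa [← hitCount_congr fun j => hθ _ (hpts1 z j)]
        · rwa [← hitCount_congr fun j => hθ _ (hpts2 z j)]
      · rintro ⟨θ, _, h⟩
        exact ⟨θ, h⟩
    rw [this]
    refine MeasurableSet.biUnion hΘ₀ fun θ _ => ?_
    exact (measurableSet_le ((measurable_hitCount (hA θ)).comp measurable_fst)
      measurable_const).inter (measurableSet_le measurable_const
        ((measurable_hitCount (hA θ)).comp measurable_snd))
  refine ⟨hEmeas, ?_⟩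
  -- every configuration has few exchanges that land in `E`
  have hpoint : ∀ z, ((Finset.univ.filter fun σ : Fin m → Bool => swapSamples σ z ∈ E).card : ℝ)
      ≤ 2 ^ m * (K * Real.exp (-(3 / 80 * T))) := by
    intro z
    obtain ⟨t, htK, ht⟩ := hgrowth (pts z) (hptsc z)
    let F : Θ → Finset (Fin m → Bool) := fun θ => Finset.univ.filter fun σ =>
      ∑ j, (if σ j then (A θ).indicator 1 (z.2 j) else (A θ).indicator 1 (z.1 j)) ≤ T ∧
        3 / 2 * T ≤ ∑ j, (if σ j then (A θ).indicator 1 (z.1 j)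
          else (A θ).indicator (1 : β → ℝ) (z.2 j))
    have hsub : (Finset.univ.filter fun σ : Fin m → Bool => swapSamples σ z ∈ E) ⊆ t.biUnion F := by
      intro σ hσ
      obtain ⟨θ, h1, h2⟩ := (Finset.mem_filter.1 hσ).2
      obtain ⟨θ', hθt, hθ⟩ := ht θ
      refine Finset.mem_biUnion.2 ⟨θ', hθt, Finset.mem_filter.2 ⟨Finset.mem_univ _, ?_, ?_⟩⟩
      · rw [hitCount_congr (B := A θ')] at h1
        · convert! h1 using 1
          simp only [swapSamples, hitCount]
          exact Finset.sum_congr rfl fun j _ => by split_ifs <;> rfl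
        · intro j; simp only [swapSamples]; split_ifs
          exacts [hθ _ (hpts2 z j), hθ _ (hpts1 z j)]
      · rw [hitCount_congr (B := A θ')] at h2
        · convert! h2 using 1
          simp only [swapSamples, hitCount]
          exact Finset.sum_congr rfl fun j _ => by split_ifs <;> rfl
        · intro j; simp only [swapSamples]; split_ifs
          exacts [hθ _ (hpts1 z j), hθ _ (hpts2 z j)]
    have hind : ∀ θ x, (A θ).indicator (1 : β → ℝ) x = 0 ∨ (A θ).indicator (1 : β → ℝ) x = 1 :=
      fun θ x => by by_cases h : x ∈ A θ <;> simp [h]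
    calc _ ≤ ((t.biUnion F).card : ℝ) := by exact_mod_cast Finset.card_le_card hsub
      _ ≤ ∑ θ ∈ t, ((F θ).card : ℝ) := by exact_mod_cast Finset.card_biUnion_le
      _ ≤ ∑ θ ∈ t, 2 ^ m * Real.exp (-(3 / 80 * T)) := Finset.sum_le_sum fun θ _ =>
          card_swap_le _ _ (fun j => hind θ _) (fun j => hind θ _) T
      _ = t.card * (2 ^ m * Real.exp (-(3 / 80 * T))) := by simp
      _ ≤ K * (2 ^ m * Real.exp (-(3 / 80 * T))) := by gcongr
      _ = _ := by ring
  have key : (2 : ENNReal) ^ m * μ E ≤ 2 ^ m * ENNReal.ofReal (K * Real.exp (-(3 / 80 * T))) := by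
    calc (2 : ENNReal) ^ m * μ E = ∑ σ : Fin m → Bool, μ E := by simp
      _ = ∑ σ : Fin m → Bool, ∫⁻ z, E.indicator 1 (swapSamples σ z) ∂μ := by
        refine Finset.sum_congr rfl fun σ _ => ?_
        have hσ := measurePreserving_swapSamples P (m := m) σ
        rw [hσ.lintegral_comp (measurable_one.indicator hEmeas), lintegral_indicator_one hEmeas]
      _ = ∫⁻ z, ∑ σ : Fin m → Bool, E.indicator 1 (swapSamples σ z) ∂μ := by
        rw [lintegral_finsetSum]
        intro σ _
        exact (measurable_one.indicator hEmeas).comp (measurePreserving_swapSamples P σ).measurable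
      _ ≤ ∫⁻ z, ENNReal.ofReal (2 ^ m * (K * Real.exp (-(3 / 80 * T)))) ∂μ := by
        refine lintegral_mono fun z => ?_
        have : ∑ σ : Fin m → Bool,
              E.indicator (1 : (Fin m → β) × (Fin m → β) → ENNReal) (swapSamples σ z)
            = ENNReal.ofReal
              ((Finset.univ.filter fun σ : Fin m → Bool => swapSamples σ z ∈ E).card : ℝ) := by
          simp [Set.indicator_apply]
        rw [this]
        exact ENNReal.ofReal_le_ofReal (hpoint z)
      _ = _ := by
        rw [ENNReal.ofReal_mul (by positivity)]
        simp [ENNReal.ofReal_pow]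
  exact (ENNReal.mul_le_mul_iff_right (by simp) (by simp)).1 key

/-- Uniform convergence with relative deviation: if the family cuts out at most `K` traces on sets
of `2 m` points, then with high probability every member of probability more than `2 ε` is hit more
than `ε m` times. The event on the left need not be measurable, so its measure is an outer measure;
this is harmless, as each of its samples `M` lies in the measurable set of those for which an
independent second sample completes the double-sample event with probability at least `1 / 2`. -/
theorem measure_exists_hitCount_le {β Θ : Type*} [MeasurableSpace β] (P : Measure β)
    [IsProbabilityMeasure P] {A : Θ → Set β} (hA : ∀ θ, MeasurableSet (A θ))
    {Θ₀ : Set Θ} (hΘ₀ : Θ₀.Countable)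
    (hdense : ∀ (s : Finset β) (θ : Θ), ∃ θ₀ ∈ Θ₀, ∀ x ∈ s, x ∈ A θ ↔ x ∈ A θ₀)
    {m : ℕ} {K : ℝ}
    (hgrowth : ∀ s : Finset β, s.card ≤ 2 * m → ∃ t : Finset Θ, (t.card : ℝ) ≤ K ∧
      ∀ θ, ∃ θ' ∈ t, ∀ x ∈ s, x ∈ A θ ↔ x ∈ A θ')
    {ε : ℝ} (hm : 12 ≤ ε * m) :
    (Measure.pi fun _ : Fin m => P) {M | ∃ θ, 2 * ε < P.real (A θ) ∧ hitCount (A θ) M ≤ ε * m}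
      ≤ ENNReal.ofReal (2 * (K * Real.exp (-(3 / 80 * (ε * m))))) := by
  obtain ⟨hE, hbound⟩ := measure_prod_exists_hitCount_le P hA hΘ₀ hdense hgrowth (ε * m)
  set E := {z : (Fin m → β) × (Fin m → β) |
        ∃ θ, hitCount (A θ) z.1 ≤ ε * m ∧ 3 / 2 * (ε * m) ≤ hitCount (A θ) z.2}
  set Q := Measure.pi fun _ : Fin m => P
  have hsub : {M | ∃ θ, 2 * ε < P.real (A θ) ∧ hitCount (A θ) M ≤ ε * m} ⊆
      {M | 2⁻¹ ≤ Q (Prod.mk M ⁻¹' E)} := by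
    rintro M ⟨θ, h1, h2⟩
    have hp : 2 * (ε * m) ≤ P.real (A θ) * m := by
      rw [← mul_assoc]; gcongr
    have h3 := half_le_hitCount P (hA θ) (m := m) (by linarith)
    have h4 : {M' : Fin m → β | 3 / 4 * (P.real (A θ) * m) ≤ hitCount (A θ) M'}
        ⊆ Prod.mk M ⁻¹' E := fun M' hM' => ⟨θ, h2, by
          have : 3 / 4 * (P.real (A θ) * m) ≤ hitCount (A θ) M' := hM'
          change 3 / 2 * (ε * m) ≤ hitCount (A θ) M'
          linarith⟩
    have h5 := h3.trans (measureReal_mono (μ := Q) h4)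
    have h6 := ENNReal.ofReal_le_ofReal h5
    rw [ofReal_measureReal] at h6
    simpa using h6
  calc Q _ ≤ Q {M | 2⁻¹ ≤ Q (Prod.mk M ⁻¹' E)} := measure_mono hsub
    _ = 2 * (2⁻¹ * Q {M | 2⁻¹ ≤ Q (Prod.mk M ⁻¹' E)}) := by
      rw [← mul_assoc, ENNReal.mul_inv_cancel (by simp) (by simp), one_mul]
    _ ≤ 2 * ∫⁻ M, Q (Prod.mk M ⁻¹' E) ∂Q := by
      gcongr
      exact mul_meas_ge_le_lintegral (measurable_measure_prodMk_left hE) _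
    _ = 2 * (Q.prod Q) E := by rw [Measure.prod_apply hE]
    _ ≤ 2 * ENNReal.ofReal (K * Real.exp (-(3 / 80 * (ε * m)))) := by gcongr
    _ = _ := by rw [ENNReal.ofReal_mul (p := 2) (by norm_num)]; simp

/-! ### Traces of half-spaces on finite sets -/

/-- The open half-space `{x | 0 < rᵀ x + c}` on which the threshold function with parameters
`θ = (r, c)` takes the value `1`. -/
def halfSpace {d : ℕ} (θ : Instance d × ℝ) : Set (Instance d) := {x | 0 < inner ℝ θ.1 x + θ.2}

theorem measurableSet_halfSpace {d : ℕ} (θ : Instance d × ℝ) : MeasurableSet (halfSpace θ) := by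
  unfold halfSpace
  exact (isOpen_lt continuous_const (by fun_prop)).measurableSet

theorem convex_halfSpace {d : ℕ} (θ : Instance d × ℝ) : Convex ℝ (halfSpace θ) := by
  have := convex_halfSpace_gt (𝕜 := ℝ) (f := fun x => inner ℝ θ.1 x)
    (innerₗ (Instance d) θ.1).isLinear (-θ.2)
  convert! this using 1
  ext x
  simp [halfSpace, neg_lt_iff_pos_add]

theorem convex_compl_halfSpace {d : ℕ} (θ : Instance d × ℝ) : Convex ℝ (halfSpace θ)ᶜ := by
  have := convex_halfSpace_le (𝕜 := ℝ) (f := fun x => inner ℝ θ.1 x)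
    (innerₗ (Instance d) θ.1).isLinear (-θ.2)
  convert! this using 1
  ext x
  simp [halfSpace, le_neg_iff_add_nonpos_right]

/-- Countably many half-spaces realise every trace of a half-space on a finite set: lowering the
offset makes all the inequalities strict, hence stable under a small change of the parameters. -/
theorem exists_countable_halfSpace (d : ℕ) : ∃ Θ₀ : Set (Instance d × ℝ), Θ₀.Countable ∧
    ∀ (s : Finset (Instance d)) (θ : Instance d × ℝ),
      ∃ θ₀ ∈ Θ₀, ∀ x ∈ s, x ∈ halfSpace θ ↔ x ∈ halfSpace θ₀ := by
  obtain ⟨Θ₀, hcount, hdense⟩ := TopologicalSpace.exists_countable_dense (Instance d × ℝ)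
  refine ⟨Θ₀, hcount, fun s θ => ?_⟩
  let U : Set (Instance d × ℝ) := ⋂ x ∈ s, {θ' | (x ∈ halfSpace θ → 0 < inner ℝ θ'.1 x + θ'.2) ∧
    (x ∉ halfSpace θ → inner ℝ θ'.1 x + θ'.2 < 0)}
  have hU : IsOpen U := by
    refine isOpen_biInter_finset fun x _ => ?_
    by_cases hx : x ∈ halfSpace θ
    · simpa [hx] using isOpen_lt continuous_const (by fun_prop)
    · simpa [hx] using isOpen_lt (by fun_prop) continuous_const
  have hne : U.Nonempty := by
    have : ∀ᶠ η in nhdsWithin (0 : ℝ) (Set.Ioi 0), ∀ x ∈ s,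
        x ∈ halfSpace θ → η < inner ℝ θ.1 x + θ.2 := by
      refine (Finset.eventually_all s).2 fun x _ => ?_
      by_cases hx : x ∈ halfSpace θ
      · have h0 : (0 : ℝ) < inner ℝ θ.1 x + θ.2 := hx
        filter_upwards [mem_nhdsWithin_of_mem_nhds (Iio_mem_nhds h0)] with η hη _ using hη
      · simp [hx]
    obtain ⟨η, hη, hpos⟩ := (this.and self_mem_nhdsWithin).exists
    refine ⟨(θ.1, θ.2 - η), Set.mem_iInter₂.2 fun x hx => ⟨fun h => ?_, fun h => ?_⟩⟩
    · have := hη x hx h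
      change 0 < inner ℝ θ.1 x + (θ.2 - η)
      linarith
    · have h1 : ¬ 0 < inner ℝ θ.1 x + θ.2 := h
      have h2 : 0 < η := hpos
      change inner ℝ θ.1 x + (θ.2 - η) < 0
      linarith
  obtain ⟨θ₀, hθU, hθ₀⟩ := hdense.inter_open_nonempty U hU hne
  refine ⟨θ₀, hθ₀, fun x hx => ?_⟩
  obtain ⟨h1, h2⟩ := Set.mem_iInter₂.1 hθU x hx
  exact ⟨h1, fun h => by_contra fun h' => lt_asymm (h2 h') h⟩

/-- Half-spaces in `ℝ^d` have VC dimension at most `d + 1`: by Radon's theorem a larger set splits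
into two parts with intersecting convex hulls, which no half-space separates. -/
theorem card_le_of_shattered_by_halfSpace {d : ℕ} (s : Finset (Instance d))
    (hs : ∀ t ⊆ s, ∃ θ, ∀ x ∈ s, x ∈ t ↔ x ∈ halfSpace θ) : s.card ≤ d + 1 := by
  classical
  by_contra hcard
  have hdep : ¬ AffineIndependent ℝ ((↑) : s → Instance d) := fun h => by
    have h1 := h.card_le_finrank_succ
    have h2 := Submodule.finrank_le (vectorSpan ℝ (Set.range ((↑) : s → Instance d)))
    simp only [Fintype.card_coe, finrank_euclideanSpace_fin] at h1 h2
    omega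
  obtain ⟨I, y, hy1, hy2⟩ := Convex.radon_partition hdep
  obtain ⟨θ, hθ⟩ := hs (s.filter fun x => ∃ h : x ∈ s, (⟨x, h⟩ : s) ∈ I) (Finset.filter_subset _ _)
  have h1 : y ∈ halfSpace θ := by
    refine convexHull_min ?_ (convex_halfSpace θ) hy1
    rintro _ ⟨x, hx, rfl⟩
    exact (hθ x x.2).1 (Finset.mem_filter.2 ⟨x.2, x.2, hx⟩)
  have h2 : y ∈ (halfSpace θ)ᶜ := by
    refine convexHull_min ?_ (convex_compl_halfSpace θ) hy2
    rintro _ ⟨x, hx, rfl⟩ hmem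
    obtain ⟨_, _, h⟩ := Finset.mem_filter.1 ((hθ x x.2).2 hmem)
    exact hx h
  exact h2 h1

/-- A Sauer–Shelah bound in generating-function form: a family of subsets of `s` that shatters no
set of more than `D` elements satisfies `#𝒜 * x ^ D ≤ (1 + x) ^ #s` for `0 ≤ x ≤ 1`. -/
theorem card_mul_pow_le_of_shatters {α : Type*} [DecidableEq α] {𝒜 : Finset (Finset α)}
    {s : Finset α} (hs : ∀ u ∈ 𝒜, u ⊆ s) {D : ℕ} (hD : ∀ t, 𝒜.Shatters t → t.card ≤ D)
    {x : ℝ} (hx0 : 0 ≤ x) (hx1 : x ≤ 1) : (𝒜.card : ℝ) * x ^ D ≤ (1 + x) ^ s.card := by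
  have hsub : 𝒜.shatterer ⊆ s.powerset := fun t ht => by
    obtain ⟨u, hu, htu⟩ := (Finset.mem_shatterer.1 ht).exists_superset
    exact Finset.mem_powerset.2 (htu.trans (hs u hu))
  calc (𝒜.card : ℝ) * x ^ D ≤ 𝒜.shatterer.card * x ^ D :=
        mul_le_mul_of_nonneg_right (by exact_mod_cast 𝒜.card_le_card_shatterer) (by positivity)
    _ = ∑ t ∈ 𝒜.shatterer, x ^ D := by simp
    _ ≤ ∑ t ∈ 𝒜.shatterer, x ^ t.card := Finset.sum_le_sum fun t ht =>
        pow_le_pow_of_le_one hx0 hx1 (hD t (Finset.mem_shatterer.1 ht))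
    _ ≤ ∑ t ∈ s.powerset, x ^ t.card := Finset.sum_le_sum_of_subset_of_nonneg hsub
        fun _ _ _ => by positivity
    _ = (1 + x) ^ s.card := by
        have := Finset.sum_pow_mul_eq_add_pow x 1 s
        simpa [add_comm] using this

/-- Few half-spaces realise every trace on a finite set. The free parameter `x` replaces the usual
optimised bound `(e N / D) ^ D`; a suitable choice of it spares any logarithm of the sample size. -/
theorem exists_finset_halfSpace {d N : ℕ} (s : Finset (Instance d)) (hN : s.card ≤ N) {x : ℝ}
    (hx0 : 0 < x) (hx1 : x ≤ 1) : ∃ t : Finset (Instance d × ℝ),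
      (t.card : ℝ) ≤ Real.exp (x * N) / x ^ (d + 1) ∧
      ∀ θ, ∃ θ' ∈ t, ∀ y ∈ s, y ∈ halfSpace θ ↔ y ∈ halfSpace θ' := by
  classical
  let 𝒜 := s.powerset.filter fun u => ∃ θ, ∀ y ∈ s, y ∈ u ↔ y ∈ halfSpace θ
  have hchoice : ∀ u, ∃ θ, u ∈ 𝒜 → ∀ y ∈ s, y ∈ u ↔ y ∈ halfSpace θ := fun u => by
    by_cases hu : u ∈ 𝒜
    · obtain ⟨θ, hθ⟩ := (Finset.mem_filter.1 hu).2
      exact ⟨θ, fun _ => hθ⟩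
    · exact ⟨0, fun h => absurd h hu⟩
  choose g hg using hchoice
  refine ⟨𝒜.image g, ?_, fun θ => ?_⟩
  · have hA : (𝒜.card : ℝ) * x ^ (d + 1) ≤ (1 + x) ^ s.card := by
      refine card_mul_pow_le_of_shatters
        (fun u hu => Finset.mem_powerset.1 (Finset.mem_filter.1 hu).1) (fun t ht => ?_) hx0.le hx1
      have hts : t ⊆ s := by
        obtain ⟨u, hu, htu⟩ := ht.exists_superset
        exact htu.trans (Finset.mem_powerset.1 (Finset.mem_filter.1 hu).1)
      refine card_le_of_shattered_by_halfSpace t fun v hv => ?_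
      obtain ⟨u, hu, huv⟩ := ht hv
      obtain ⟨θ, hθ⟩ := (Finset.mem_filter.1 hu).2
      refine ⟨θ, fun y hy => ?_⟩
      rw [← huv, Finset.mem_inter, ← hθ y (hts hy)]
      simp [hy]
    rw [le_div_iff₀ (by positivity)]
    calc ((𝒜.image g).card : ℝ) * x ^ (d + 1) ≤ 𝒜.card * x ^ (d + 1) := by
          gcongr; exact Finset.card_image_le
      _ ≤ (1 + x) ^ s.card := hA
      _ ≤ (1 + x) ^ N := pow_le_pow_right₀ (by linarith) hN
      _ ≤ Real.exp x ^ N := by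
          gcongr; linarith [Real.add_one_le_exp x]
      _ = Real.exp (x * N) := by rw [← Real.exp_nat_mul, mul_comm]
  · have hmem : s.filter (· ∈ halfSpace θ) ∈ 𝒜 := Finset.mem_filter.2
      ⟨Finset.mem_powerset.2 (Finset.filter_subset _ _), θ, fun y hy => by simp [hy]⟩
    refine ⟨_, Finset.mem_image_of_mem g hmem, fun y hy => ?_⟩
    rw [← hg _ hmem y hy]
    simp [hy]

/-! ### Bags with nearly deterministic totals -/

/-- If `S = X + T` with `X` a `{0, 1}`-valued variable independent of `T`, then `S` differs from
any given value at least with the smaller of the probabilities of `X = 0` and `X = 1`: for each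
value of `T` at most one value of `X` is right. -/
theorem min_le_measureReal_sum_ne {ι α : Type*} [Fintype ι] [MeasurableSpace α]
    (ν : ι → Measure α) [∀ i, IsProbabilityMeasure (ν i)] {H : Set α} (hH : MeasurableSet H)
    (i : ι) (c : ℝ) :
    min ((ν i).real H) (1 - (ν i).real H) ≤
      (Measure.pi ν).real {B | ∑ j, H.indicator (1 : α → ℝ) (B j) ≠ c} := by
  classical
  set Q := Measure.pi ν
  let X : ι → (ι → α) → ℝ := fun j B => H.indicator (1 : α → ℝ) (B j)
  have hXm : ∀ j, Measurable (X j) := fun j =>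
    (measurable_one.indicator hH).comp (measurable_pi_apply j)
  have hind : iIndepFun X Q :=
    iIndepFun_pi (X := fun _ => H.indicator (1 : α → ℝ))
      fun _ => (measurable_one.indicator hH).aemeasurable
  let T : (ι → α) → ℝ := ∑ j ∈ Finset.univ.erase i, X j
  have hTm : Measurable T := by
    rw [show T = fun B => ∑ j ∈ Finset.univ.erase i, X j B from funext (Finset.sum_apply · _ _)]
    exact Finset.measurable_sum _ fun j _ => hXm j
  have hT : IndepFun T (X i) Q :=
    hind.indepFun_finsetSum_of_notMem hXm (Finset.notMem_erase _ _)
  have hsum : ∀ B, ∑ j, H.indicator (1 : α → ℝ) (B j) = X i B + T B := fun B => by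
    simp only [T, Finset.sum_apply]
    exact (Finset.add_sum_erase _ _ (Finset.mem_univ i)).symm
  have hX01 : ∀ B, X i B = 0 ∨ X i B = 1 := fun B => by
    by_cases h : B i ∈ H <;> simp [X, h]
  have hprod : ∀ a b : ℝ, Q.real (T ⁻¹' {a} ∩ X i ⁻¹' {b})
      = Q.real (T ⁻¹' {a}) * Q.real (X i ⁻¹' {b}) := fun a b => by
    simp only [measureReal_def, ← ENNReal.toReal_mul]
    rw [hT.measure_inter_preimage_eq_mul _ _ (measurableSet_singleton _) (measurableSet_singleton _)]
  have hQ1 : Q.real (X i ⁻¹' {1}) = (ν i).real H := by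
    have : X i ⁻¹' {1} = Function.eval i ⁻¹' H := by
      ext B; by_cases h : B i ∈ H <;> simp [X, h]
    rw [this, (measurePreserving_eval ν i).measureReal_preimage hH.nullMeasurableSet]
  have hQ0 : Q.real (X i ⁻¹' {0}) = 1 - (ν i).real H := by
    have : X i ⁻¹' {0} = (X i ⁻¹' {1})ᶜ := by
      ext B; rcases hX01 B with h | h <;> simp [h]
    rw [this, probReal_compl_eq_one_sub (hXm i (measurableSet_singleton _)), hQ1]
  set p := (ν i).real H
  have hSm : MeasurableSet {B : ι → α | ∑ j, H.indicator (1 : α → ℝ) (B j) = c} := by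
    simp only [hsum]
    exact ((hXm i).add hTm) (measurableSet_singleton c)
  have hle : Q.real {B | ∑ j, H.indicator (1 : α → ℝ) (B j) = c} ≤
      Q.real (T ⁻¹' {c}) * (1 - p) + Q.real (T ⁻¹' {c - 1}) * p := by
    rw [← hQ0, ← hQ1, ← hprod, ← hprod]
    refine (measureReal_mono ?_).trans (measureReal_union_le _ _)
    intro B hB
    have hB' : X i B + T B = c := (hsum B).symm.trans hB
    rcases hX01 B with h | h
    · exact Or.inl ⟨by simp; linarith, by simp [h]⟩
    · exact Or.inr ⟨by simp; linarith, by simp [h]⟩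
  have hT1 : Q.real (T ⁻¹' {c}) + Q.real (T ⁻¹' {c - 1}) ≤ 1 := by
    rw [← measureReal_union _ (hTm (measurableSet_singleton _))]
    · exact measureReal_le_one
    · refine Set.disjoint_left.2 fun B h1 h2 => ?_
      simp only [Set.mem_preimage, Set.mem_singleton_iff] at h1 h2
      linarith
  have hcompl : Q.real {B | ∑ j, H.indicator (1 : α → ℝ) (B j) ≠ c}
      = 1 - Q.real {B | ∑ j, H.indicator (1 : α → ℝ) (B j) = c} :=
    probReal_compl_eq_one_sub hSm
  rw [hcompl]
  have h0 : 0 ≤ Q.real (T ⁻¹' {c}) := measureReal_nonneg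
  have h1 : 0 ≤ Q.real (T ⁻¹' {c - 1}) := measureReal_nonneg
  rcases le_total p (1 - p) with h | h
  · rw [min_eq_left h]; nlinarith
  · rw [min_eq_right h]; nlinarith

/-- Union bound: if labels `y` with a total other than `c` are each right with high probability,
then so is the claim that the total is not `c`. -/
theorem one_sub_sum_le_measureReal_sum_ne {ι α : Type*} [Fintype ι] [MeasurableSpace α]
    (ν : ι → Measure α) [∀ i, IsProbabilityMeasure (ν i)] {H : Set α} (hH : MeasurableSet H)
    (y : ι → ℝ) {c : ℝ} (hy : ∑ i, y i ≠ c) :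
    1 - ∑ i, (ν i).real {x | H.indicator 1 x ≠ y i} ≤
      (Measure.pi ν).real {B | ∑ j, H.indicator (1 : α → ℝ) (B j) ≠ c} := by
  set Q := Measure.pi ν
  have hm : Measurable (H.indicator (1 : α → ℝ)) := measurable_one.indicator hH
  have h1 : (1 : ℝ) = Q.real Set.univ := by simp
  have hcov : (Set.univ : Set (ι → α)) ⊆ {B | ∑ j, H.indicator (1 : α → ℝ) (B j) ≠ c} ∪
      ⋃ i, Function.eval i ⁻¹' {x | H.indicator (1 : α → ℝ) x ≠ y i} := by
    intro B _
    by_contra hB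
    simp only [Set.mem_union, Set.mem_iUnion, not_or, not_exists] at hB
    have h2 : ∀ i, H.indicator (1 : α → ℝ) (B i) = y i := fun i => not_not.1 (hB.2 i)
    exact hB.1 (by simpa [h2] using hy)
  have h2 := (measureReal_mono (μ := Q) hcov).trans (measureReal_union_le _ _)
  have h3 := measureReal_iUnion_fintype_le (μ := Q)
    (fun i => Function.eval i ⁻¹' {x | H.indicator (1 : α → ℝ) x ≠ y i})
  have h4 : ∀ i, Q.real (Function.eval i ⁻¹' {x | H.indicator (1 : α → ℝ) x ≠ y i})
      = (ν i).real {x | H.indicator (1 : α → ℝ) x ≠ y i} := fun i =>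
    (measurePreserving_eval ν i).measureReal_preimage
      (hm (measurableSet_singleton _).compl).nullMeasurableSet
  simp only [h4] at h3
  rw [← h1] at h2
  linarith

/-- If a random bag of `k` instances from `μ₁` and `q - k` from `μ₀` meets `H` in exactly `k`
instances outside an event of probability `η < 1 / (q + 1)`, then `H` has probability at least
`1 - η` under `μ₁` and at most `η` under `μ₀`, or the other way round; the latter forces
`q - k = k`. -/
theorem bag_dichotomy {α : Type*} [MeasurableSpace α] (μ₁ μ₀ : Measure α)
    [IsProbabilityMeasure μ₁] [IsProbabilityMeasure μ₀] {H : Set α} (hH : MeasurableSet H)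
    {q k : ℕ} (hk : 1 ≤ k) (hkq : k < q) {η : ℝ} (hη : (q + 1) * η < 1)
    (hP : (Measure.pi fun i : Fin q => if (i : ℕ) < k then μ₁ else μ₀).real
      {B | ∑ j, H.indicator (1 : α → ℝ) (B j) ≠ k} ≤ η) :
    (μ₁.real Hᶜ ≤ η ∧ μ₀.real H ≤ η) ∨
      ((k : ℝ) = q / 2 ∧ μ₁.real H ≤ η ∧ μ₀.real Hᶜ ≤ η) := by
  classical
  set ν : Fin q → Measure α := fun i => if (i : ℕ) < k then μ₁ else μ₀ with hν
  have hprob : ∀ i, IsProbabilityMeasure (ν i) := fun i => by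
    simp only [hν]; split_ifs <;> infer_instance
  have hsum : ∀ u v : ℝ, ∑ i : Fin q, (if (i : ℕ) < k then u else v) = k * u + (q - k) * v := by
    intro u v
    rw [Fin.sum_univ_eq_sum_range (fun i => if i < k then u else v) q,
      ← Finset.sum_range_add_sum_Ico _ hkq.le,
      Finset.sum_congr rfl fun i hi => if_pos (Finset.mem_range.1 hi),
      Finset.sum_congr rfl fun i hi => if_neg (Finset.mem_Ico.1 hi).1.not_gt]
    simp [Nat.cast_sub hkq.le]
  have hkR : (1 : ℝ) ≤ k := by exact_mod_cast hk
  have hkqR : (k : ℝ) < q := by exact_mod_cast hkq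
  have hc1 : μ₁.real Hᶜ = 1 - μ₁.real H := probReal_compl_eq_one_sub hH
  have hc0 : μ₀.real Hᶜ = 1 - μ₀.real H := probReal_compl_eq_one_sub hH
  have h1 : min (μ₁.real H) (1 - μ₁.real H) ≤ η := by
    have := (min_le_measureReal_sum_ne ν hH ⟨0, by omega⟩ k).trans hP
    simpa [hν, show 0 < k by omega] using this
  have h0 : min (μ₀.real H) (1 - μ₀.real H) ≤ η := by
    have := (min_le_measureReal_sum_ne ν hH ⟨k, hkq⟩ k).trans hP
    simpa [hν] using this
  -- labels `a` on `μ₁` and `b` on `μ₀` that are right up to `η` have to give the right total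
  have htotal : ∀ a b : ℝ, μ₁.real {x | H.indicator 1 x ≠ a} ≤ η →
      μ₀.real {x | H.indicator 1 x ≠ b} ≤ η → k * a + (q - k) * b = k := by
    intro a b ha hb
    by_contra hne
    have h := (one_sub_sum_le_measureReal_sum_ne ν hH (fun i => if (i : ℕ) < k then a else b)
      (by rwa [hsum])).trans hP
    have h' : ∑ i, (ν i).real {x | H.indicator 1 x ≠ if (i : ℕ) < k then a else b}
        ≤ ∑ i : Fin q, η := Finset.sum_le_sum fun i _ => by
      simp only [hν]; split_ifs <;> assumption
    simp only [Finset.sum_const, Finset.card_univ, Fintype.card_fin, nsmul_eq_mul] at h'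
    linarith
  have hset1 : {x | H.indicator (1 : α → ℝ) x ≠ 1} = Hᶜ := by
    ext x; by_cases h : x ∈ H <;> simp [h]
  have hset0 : {x | H.indicator (1 : α → ℝ) x ≠ 0} = H := by
    ext x; by_cases h : x ∈ H <;> simp [h]
  rcases min_le_iff.1 h1 with h1 | h1 <;> rcases min_le_iff.1 h0 with h0 | h0
  · have := htotal 0 0 (by rwa [hset0]) (by rwa [hset0])
    linarith
  · have := htotal 0 1 (by rwa [hset0]) (by rwa [hset1, hc0])
    exact Or.inr ⟨by linarith, h1, hc0 ▸ h0⟩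
  · exact Or.inl ⟨hc1 ▸ h1, h0⟩
  · have := htotal 1 1 (by rwa [hset1, hc1]) (by rwa [hset1, hc0])
    linarith

theorem measureReal_inter_union_inter_compl_le {α : Type*} [MeasurableSpace α] (μ : Measure α)
    [IsProbabilityMeasure μ] {F : Set α} (hF : MeasurableSet F) {η : ℝ} {S T : Set α}
    (hS : μ[|F].real S ≤ η) (hT : μ[|Fᶜ].real T ≤ η) : μ.real (F ∩ S ∪ Fᶜ ∩ T) ≤ η := by
  have h : ∀ {G U : Set α}, MeasurableSet G → μ[|G].real U ≤ η → μ.real (G ∩ U) ≤ μ.real G * η := by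
    intro G U hG hU
    have : μ.real (G ∩ U) = μ.real G * μ[|G].real U := by
      have hcond : μ[|G].real U = (μ.real G)⁻¹ * μ.real (G ∩ U) := by
        simp [measureReal_def, cond_apply hG]
      rw [hcond]
      by_cases h0 : μ.real G = 0
      · rw [h0, zero_mul]
        exact measureReal_mono_null Set.inter_subset_left h0
      · field_simp
    rw [this]
    exact mul_le_mul_of_nonneg_left hU measureReal_nonneg
  have h1 := h hF hS
  have h2 := h hF.compl hT
  have h3 := measureReal_union_le (μ := μ) (F ∩ S) (Fᶜ ∩ T)
  rw [probReal_compl_eq_one_sub hF] at h2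
  linarith

/-! ### Bag errors of half-spaces -/

theorem isLTF_iff_exists_halfSpace {d : ℕ} {h : Instance d → ℝ} :
    IsLTF h ↔ ∃ θ, h = (halfSpace θ).indicator 1 := by
  classical
  constructor
  · rintro ⟨r, c, hh⟩
    exact ⟨(r, c), funext fun x => by simp [hh, pos, halfSpace, Set.indicator_apply]⟩
  · rintro ⟨θ, rfl⟩
    exact ⟨θ.1, θ.2, fun x => by simp [pos, halfSpace, Set.indicator_apply]⟩

/-- The bags in which the number of instances that `θ` labels `1` is not `k`. -/
def errorBags {d : ℕ} (q k : ℕ) (θ : Instance d × ℝ) : Set (Bag d q) :=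
  {B | ∑ j, (halfSpace θ).indicator (1 : Instance d → ℝ) (B j) ≠ k}

theorem measurableSet_errorBags {d : ℕ} (q k : ℕ) (θ : Instance d × ℝ) :
    MeasurableSet (errorBags q k θ) := by
  have : Measurable fun B : Bag d q =>
      ∑ j, (halfSpace θ).indicator (1 : Instance d → ℝ) (B j) :=
    Finset.measurable_sum _ fun j _ =>
      (measurable_one.indicator (measurableSet_halfSpace θ)).comp (measurable_pi_apply j)
  exact (this (measurableSet_singleton (k : ℝ))).compl

theorem mem_errorBags_congr {d q : ℕ} (k : ℕ) {θ θ' : Instance d × ℝ} {B : Bag d q}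
    (h : ∀ i, B i ∈ halfSpace θ ↔ B i ∈ halfSpace θ') :
    B ∈ errorBags q k θ ↔ B ∈ errorBags q k θ' := by
  classical
  have : ∑ j, (halfSpace θ).indicator (1 : Instance d → ℝ) (B j)
      = ∑ j, (halfSpace θ').indicator (1 : Instance d → ℝ) (B j) :=
    Finset.sum_congr rfl fun j _ => by simp only [Set.indicator_apply, h j]
  change _ ≠ _ ↔ _ ≠ _
  rw [this]

theorem bagErrSample_eq {d q m : ℕ} (hq : 0 < q) (k : ℕ) (θ : Instance d × ℝ)
    (M : Fin m → Bag d q) :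
    bagErrSample ((halfSpace θ).indicator 1) k M = hitCount (errorBags q k θ) M / m := by
  classical
  have hq' : (q : ℝ) ≠ 0 := by exact_mod_cast hq.ne'
  have h : ∀ j, bagAvg ((halfSpace θ).indicator 1) (M j) ≠ (k : ℝ) / q ↔
      M j ∈ errorBags q k θ := fun j => by
    rw [bagAvg, Ne, div_left_inj' hq']
    rfl
  simp only [bagErrSample, hitCount, h, Set.indicator_apply, Pi.one_apply, Finset.sum_boole]

/-- Uniform convergence for the bag errors of half-spaces: the error on `2 m` bags is determined by
the trace of the half-space on the `2 m q` instances in them. -/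
theorem measure_exists_bad_halfSpace_le {d q k m : ℕ} (P : Measure (Bag d q))
    [IsProbabilityMeasure P] {ε x : ℝ} (hm : 12 ≤ ε * m) (hx0 : 0 < x) (hx1 : x ≤ 1) :
    (Measure.pi fun _ : Fin m => P)
      {M | ∃ θ, 2 * ε < P.real (errorBags q k θ) ∧ hitCount (errorBags q k θ) M ≤ ε * m}
      ≤ ENNReal.ofReal (2 * (Real.exp (x * (2 * m * q : ℕ)) / x ^ (d + 1) *
        Real.exp (-(3 / 80 * (ε * m))))) := by
  classical
  obtain ⟨Θ₀, hcount, hdense⟩ := exists_countable_halfSpace d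
  let pts : Finset (Bag d q) → Finset (Instance d) := fun s =>
    s.biUnion fun B => Finset.univ.image B
  have hpts : ∀ s, ∀ B ∈ s, ∀ i, B i ∈ pts s := fun s B hB i =>
    Finset.mem_biUnion.2 ⟨B, hB, Finset.mem_image_of_mem _ (Finset.mem_univ i)⟩
  refine measure_exists_hitCount_le P (fun θ => measurableSet_errorBags q k θ) hcount
    (fun s θ => ?_) (fun s hs => ?_) hm
  · obtain ⟨θ₀, h0, h⟩ := hdense (pts s) θ
    exact ⟨θ₀, h0, fun B hB => mem_errorBags_congr k fun i => h _ (hpts s B hB i)⟩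
  · have hcard : (pts s).card ≤ 2 * m * q := by
      refine (Finset.card_biUnion_le_card_mul s _ q fun B _ => ?_).trans
        (Nat.mul_le_mul_right q hs)
      simpa using Finset.card_image_le (s := (Finset.univ : Finset (Fin q))) (f := B)
    obtain ⟨t, ht, h⟩ := exists_finset_halfSpace (pts s) hcard hx0 hx1
    refine ⟨t, ht, fun θ => ?_⟩
    obtain ⟨θ', hθ', h'⟩ := h θ
    exact ⟨θ', hθ', fun B hB => mem_errorBags_congr k fun i => h' _ (hpts s B hB i)⟩

/-- A half-space whose bag error over the distribution is at most `2 ε` is, up to `2 ε`, the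
target half-space or, if `k = q / 2`, its complement. -/
theorem instErr_le_of_bagOracle_errorBags_le {d q k : ℕ} (𝒟 : Measure (Instance d))
    [IsProbabilityMeasure 𝒟] {φ θ : Instance d × ℝ} (hk : 1 ≤ k) (hkq : k < q)
    (h1 : 𝒟 (halfSpace φ) ≠ 0) (h0 : 𝒟 (halfSpace φ)ᶜ ≠ 0) {ε : ℝ} (hε : ε < 1 / (4 * (q : ℝ)))
    (hP : (bagOracle ((halfSpace φ).indicator 1) 𝒟 q k).real (errorBags q k θ) ≤ 2 * ε) :
    instErr 𝒟 ((halfSpace φ).indicator 1) ((halfSpace θ).indicator 1) ≤ 2 * ε ∨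
      ((k : ℝ) = q / 2 ∧
        instErr 𝒟 ((halfSpace φ).indicator 1) (fun x => 1 - (halfSpace θ).indicator 1 x)
          ≤ 2 * ε) := by
  classical
  have hF := measurableSet_halfSpace φ
  have hH := measurableSet_halfSpace θ
  set F := halfSpace φ
  set H := halfSpace θ with hHdef
  have := cond_isProbabilityMeasure h1
  have := cond_isProbabilityMeasure h0
  have hF1 : {x | F.indicator (1 : Instance d → ℝ) x = 1} = F := by
    ext x; by_cases h : x ∈ F <;> simp [h]
  have hF0 : {x | F.indicator (1 : Instance d → ℝ) x = 0} = Fᶜ := by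
    ext x; by_cases h : x ∈ F <;> simp [h]
  simp only [bagOracle, condLabel, hF1, hF0, errorBags, ← hHdef] at hP
  have hqR : (2 : ℝ) ≤ q := by exact_mod_cast (by omega : 2 ≤ q)
  have hη : (q + 1) * (2 * ε) < 1 := by
    rw [lt_div_iff₀ (by positivity)] at hε
    nlinarith
  rcases bag_dichotomy (𝒟[|F]) (𝒟[|Fᶜ]) hH hk hkq hη hP with ⟨ha, hb⟩ | ⟨hkk, ha, hb⟩
  · left
    refine le_trans (measureReal_mono ?_) (measureReal_inter_union_inter_compl_le 𝒟 hF ha hb)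
    intro x hx
    by_cases hxF : x ∈ F <;> by_cases hxH : x ∈ H <;> simp_all
  · right
    refine ⟨hkk, ?_⟩
    refine le_trans (measureReal_mono ?_) (measureReal_inter_union_inter_compl_le 𝒟 hF ha hb)
    intro x hx
    by_cases hxF : x ∈ F <;> by_cases hxH : x ∈ H <;> simp_all

/-! ### The sample size -/

/-- The choice `x = 3 ε / (320 q)` in `measure_exists_bad_halfSpace_le` lets the growth factor
`exp (2 m q x)` use up only half of the decay `exp (-3 ε m / 80)`. The remaining factor
`x ^ (-(d + 1))` is absorbed through `log (1 / ε) ≤ 1 / ε`, which is where the hypothesis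
`m ≳ 1 / ε ^ 2`, stronger than `m ≳ log (1 / ε) / ε`, enters. -/
theorem failure_bound_le_of_sample_size {d q m : ℕ} {ε δ : ℝ} (hd : 1 ≤ d) (hq : 2 ≤ q)
    (hε : 0 < ε) (hε8 : ε ≤ 1 / 8) (hδ0 : 0 < δ) (hδ1 : δ < 1)
    (hm : 2400 * (d : ℝ) * (Real.log q + Real.log (1 / δ)) / ε ^ 2 ≤ m) :
    12 ≤ ε * m ∧
      2 * (Real.exp (3 * ε / (320 * q) * (2 * m * q : ℕ)) / (3 * ε / (320 * q)) ^ (d + 1) *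
        Real.exp (-(3 / 80 * (ε * m)))) ≤ δ := by
  have hdR : (1 : ℝ) ≤ d := by exact_mod_cast hd
  have hqR : (2 : ℝ) ≤ q := by exact_mod_cast hq
  have hq0 : (0 : ℝ) < q := by linarith
  have hlogq : Real.log 2 ≤ Real.log q := Real.log_le_log (by norm_num) hqR
  have hlogδ : 0 < Real.log (1 / δ) := Real.log_pos (by rw [lt_div_iff₀ hδ0]; linarith)
  have hlog2 := Real.log_two_gt_d9
  have hlog2' := Real.log_two_lt_d9
  set L := Real.log q + Real.log (1 / δ) with hL
  have hL0 : 69 / 100 ≤ L := by linarith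
  set R := 1 / ε with hR
  have hR8 : 8 ≤ R := by rw [hR, le_div_iff₀ hε]; linarith
  have hmR : 2400 * (d * L * R) ≤ ε * m := by
    have : 2400 * (d * L * R) = ε * (2400 * (d : ℝ) * L / ε ^ 2) := by
      rw [hR]; field_simp
    rw [this]
    exact mul_le_mul_of_nonneg_left hm hε.le
  have hLR : 69 / 100 * R ≤ L * R := by gcongr
  have hdLR : L * R ≤ d * L * R := by
    have : 0 ≤ L * R := by positivity
    nlinarith
  refine ⟨by linarith, ?_⟩
  set x := 3 * ε / (320 * q) with hx
  have hx0 : 0 < x := by positivity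
  have hxm : x * (2 * m * q : ℕ) = 3 / 160 * (ε * m) := by
    rw [hx]; push_cast; field_simp; ring
  have hlogx : -Real.log x ≤ 15 * R + L := by
    have h1 : x⁻¹ = 320 / 3 * (q * R) := by rw [hx, hR]; field_simp
    rw [← Real.log_inv, h1, Real.log_mul (by norm_num) (by positivity),
      Real.log_mul (by positivity) (by positivity)]
    have h2 := Real.log_le_sub_one_of_pos (show (0 : ℝ) < 320 / 3 by norm_num)
    have h3 := Real.log_le_sub_one_of_pos (show (0 : ℝ) < R by positivity)
    linarith
  have hpow : x ^ (d + 1) = Real.exp ((d + 1) * Real.log x) := by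
    rw [← Real.exp_log hx0, ← Real.exp_nat_mul, Real.exp_log hx0]; push_cast; rfl
  have hmain : Real.log 2 + (3 / 160 * (ε * m) - (d + 1) * Real.log x + -(3 / 80 * (ε * m)))
      ≤ Real.log δ := by
    have h1 : Real.log δ = -Real.log (1 / δ) := by rw [one_div, Real.log_inv, neg_neg]
    have h2 : (d + 1) * -Real.log x ≤ (2 * d) * (15 * R + L) :=
      (mul_le_mul_of_nonneg_left hlogx (by positivity)).trans
        (mul_le_mul_of_nonneg_right (by linarith) (by positivity))
    have h3 : (d : ℝ) * (69 / 100 * R) ≤ d * (L * R) := by gcongr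
    have h4 : (d : ℝ) * (L * 8) ≤ d * (L * R) := by gcongr
    have h5 : L * 1 ≤ L * d := by gcongr
    nlinarith
  calc 2 * (Real.exp (x * (2 * m * q : ℕ)) / x ^ (d + 1) * Real.exp (-(3 / 80 * (ε * m))))
      = Real.exp (Real.log 2 +
          (3 / 160 * (ε * m) - (d + 1) * Real.log x + -(3 / 80 * (ε * m)))) := by
        rw [hxm, hpow, ← Real.exp_sub, ← Real.exp_add, Real.exp_add (Real.log 2),
          Real.exp_log (by norm_num)]
    _ ≤ Real.exp (Real.log δ) := Real.exp_le_exp.2 hmain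
    _ = δ := Real.exp_log hδ0

theorem theorem4 :
    ∃ C₀ : ℝ, 0 < C₀ ∧
      ∀ (d q k m : ℕ) (𝒟 : Measure (Instance d)) (f : Instance d → ℝ) (ε δ : ℝ),
        IsProbabilityMeasure 𝒟 →
        1 ≤ k → k < q →
        IsLTF f →
        𝒟 {x | f x = 1} ≠ 0 → 𝒟 {x | f x = 0} ≠ 0 →
        0 < ε → ε < 1 / (4 * (q : ℝ)) →
        0 < δ →
        C₀ * (d : ℝ) * (Real.log (q : ℝ) + Real.log (1 / δ)) / ε ^ 2 ≤ (m : ℝ) →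
        -- with probability at least `1 - δ` over the sampled bags, for every LTF `h`
        ∃ G : Set (Fin m → Bag d q), MeasurableSet G ∧
          ENNReal.ofReal (1 - δ) ≤ sampleLaw f 𝒟 q k m G ∧
          ∀ M ∈ G, ∀ h : Instance d → ℝ, IsLTF h → bagErrSample h k M ≤ ε →
            ((k : ℝ) ≠ (q : ℝ) / 2 → instErr 𝒟 f h ≤ 4 * ε) ∧
            ((k : ℝ) = (q : ℝ) / 2 →
              instErr 𝒟 f h ≤ 4 * ε ∨ instErr 𝒟 f (fun x => 1 - h x) ≤ 4 * ε) := by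
  classical
  refine ⟨2400, by norm_num, ?_⟩
  intro d q k m 𝒟 f ε δ _ hk hkq hf h1 h0 hε hεq hδ hm
  rcases le_or_gt 1 δ with hδ1 | hδ1
  -- for `1 ≤ δ` the probability bound is void, and `log (1 / δ)` may be negative
  · exact ⟨∅, MeasurableSet.empty, by simp [ENNReal.ofReal_of_nonpos (sub_nonpos.2 hδ1)], by simp⟩
  obtain ⟨φ, rfl⟩ := isLTF_iff_exists_halfSpace.1 hf
  have hF1 : {x | (halfSpace φ).indicator (1 : Instance d → ℝ) x = 1} = halfSpace φ := by
    ext x; by_cases h : x ∈ halfSpace φ <;> simp [h]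
  have hF0 : {x | (halfSpace φ).indicator (1 : Instance d → ℝ) x = 0} = (halfSpace φ)ᶜ := by
    ext x; by_cases h : x ∈ halfSpace φ <;> simp [h]
  rw [hF1] at h1
  rw [hF0] at h0
  -- on the one-point space `ℝ^0` no function takes both values
  have hd : 1 ≤ d := by
    by_contra hd
    obtain rfl : d = 0 := by omega
    obtain ⟨x, hx⟩ := nonempty_of_measure_ne_zero h1
    obtain ⟨y, hy⟩ := nonempty_of_measure_ne_zero h0
    exact hy (Subsingleton.elim x y ▸ hx)
  have hq : 2 ≤ q := by omega
  have hqR : (2 : ℝ) ≤ q := by exact_mod_cast hq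
  have hε8 : ε ≤ 1 / 8 := hεq.le.trans (one_div_le_one_div_of_le (by norm_num) (by linarith))
  obtain ⟨hεm, hbound⟩ := failure_bound_le_of_sample_size hd hq hε hε8 hδ hδ1 hm
  have hm0 : (0 : ℝ) < m := by
    by_contra h
    nlinarith
  set P := bagOracle ((halfSpace φ).indicator 1) 𝒟 q k with hPdef
  have : IsProbabilityMeasure P := by
    have := cond_isProbabilityMeasure h1
    have := cond_isProbabilityMeasure h0
    have : ∀ i : Fin q, IsProbabilityMeasure
        (if (i : ℕ) < k then 𝒟[|halfSpace φ] else 𝒟[|(halfSpace φ)ᶜ]) := fun i => by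
      split_ifs <;> infer_instance
    simp only [hPdef, bagOracle, condLabel, hF1, hF0]
    infer_instance
  set bad := {M : Fin m → Bag d q | ∃ θ, 2 * ε < P.real (errorBags q k θ) ∧
    hitCount (errorBags q k θ) M ≤ ε * m} with hbaddef
  have hbad : sampleLaw ((halfSpace φ).indicator 1) 𝒟 q k m bad ≤ ENNReal.ofReal δ :=
    (measure_exists_bad_halfSpace_le P hεm (by positivity)
      ((div_le_one (by positivity)).2 (by linarith))).trans (ENNReal.ofReal_le_ofReal hbound)
  have : IsProbabilityMeasure (sampleLaw ((halfSpace φ).indicator 1) 𝒟 q k m) :=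
    inferInstanceAs (IsProbabilityMeasure (Measure.pi fun _ : Fin m => P))
  -- the bad event is replaced by a measurable hull of the same measure
  refine ⟨(toMeasurable (sampleLaw ((halfSpace φ).indicator 1) 𝒟 q k m) bad)ᶜ,
    (measurableSet_toMeasurable _ _).compl, ?_, ?_⟩
  · rw [prob_compl_eq_one_sub (measurableSet_toMeasurable _ _), measure_toMeasurable,
      ENNReal.ofReal_sub _ hδ.le, ENNReal.ofReal_one]
    exact tsub_le_tsub_left hbad 1
  · intro M hM h hh herr
    obtain ⟨θ, rfl⟩ := isLTF_iff_exists_halfSpace.1 hh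
    have hMbad : M ∉ bad := fun h => hM (subset_toMeasurable _ _ h)
    rw [bagErrSample_eq (by omega), div_le_iff₀ hm0] at herr
    have hpop : P.real (errorBags q k θ) ≤ 2 * ε := by
      by_contra hlt
      exact hMbad ⟨θ, not_le.1 hlt, herr⟩
    rcases instErr_le_of_bagOracle_errorBags_le 𝒟 hk hkq h1 h0 hεq hpop with hle | ⟨hkk, hle⟩
    · exact ⟨fun _ => by linarith, fun _ => Or.inl (by linarith)⟩
    · exact ⟨fun hne => absurd hkk hne, fun _ => Or.inr (by linarith)⟩
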